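/- Let $n\ge 1$ be an integer, let $\alpha>0$, let $f:[0,\alpha)\to\mathbb R$ be a $C^2$ function (with one-sided derivatives at $0$), and let $g:(0,\alpha)\to\mathbb R$ be defined by $f(t)=t\,g(t)$. For a $C^2$ function $h$ on $(0,\alpha)$ write $[x,y]_h=\frac{h(x)-h(y)}{x-y}$ if $x\neq y$ and $[x,x]_h=h'(x)$; and let $[x,y,z]_h$ be the second divided difference, which is invariant under permutations of $x,y,z$ and is given by $[x,y,z]_h=\frac{[x,y]_h-[y,z]_h}{x-z}$ if $x\ne z$ and by $[x,x,x]_h=\frac{h''(x)}{2}$. A real function $h$ on an interval $I$ is called $n$-monotone if $A\le B$ implies $h(A)\le h(B)$, and $n$-convex if $h(\lambda A+(1-\lambda)B)\le\lambda h(A)+(1-\lambda)h(B)$ for all $\lambda\in[0,1]$, in each case for all self-adjoint complex $n\times n$ matrices $A,B$ with all eigenvalues in $I$; here $\le$ is the Loewner order. Then: 1. $g$ is a $C^2$ function on $(0,\alpha)$. 2. For any distinct points $t_1,\dots,t_n\in(0,\alpha)$ and all $1\le i,j\le n$ (including $i=j$, $i=1$ and $j=1$), $$[t_1,t_i,t_j]_f=t_1\,[t_1,t_i,t_j]_g+[t_i,t_j]_g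 .$$ 3. If $g$ is both $n$-monotone and $n$-convex on $(0,\alpha)$, then $f$ is $n$-convex on $[0,\alpha)$. -/

import Mathlib

section MatrixFunctions

open scoped ComplexOrder MatrixOrder

/-- `f` is `n`-monotone (matrix monotone of order `n`) on `I`: if `A ≤ B` are self-adjoint complex
`n × n` matrices with all eigenvalues in `I`, then `f(A) ≤ f(B)`.  Here `≤` is the Loewner order
and `f(A)` is given by the functional calculus. (The spectrum is finite, so every `f` is
continuous on it and no continuity assumption is needed for `cfc`.) -/
def MatrixMonotoneOn (n : ℕ) (I : Set ℝ) (f : ℝ → ℝ) : Prop :=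
  ∀ A B : Matrix (Fin n) (Fin n) ℂ, IsSelfAdjoint A → IsSelfAdjoint B →
    spectrum ℝ A ⊆ I → spectrum ℝ B ⊆ I → A ≤ B → cfc f A ≤ cfc f B

/-- `f` is `n`-convex (matrix convex of order `n`) on `I`:
`f(cA + (1-c)B) ≤ c f(A) + (1-c) f(B)` for `c ∈ [0,1]` and all self-adjoint complex
`n × n` matrices `A`, `B` with all eigenvalues in `I`. -/
def MatrixConvexOn (n : ℕ) (I : Set ℝ) (f : ℝ → ℝ) : Prop :=
  ∀ A B : Matrix (Fin n) (Fin n) ℂ, IsSelfAdjoint A → IsSelfAdjoint B →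
    spectrum ℝ A ⊆ I → spectrum ℝ B ⊆ I → ∀ c : ℝ, c ∈ Set.Icc (0 : ℝ) 1 →
      cfc f (c • A + (1 - c) • B) ≤ c • cfc f A + (1 - c) • cfc f B

end MatrixFunctions

/-- The first divided difference `[x, y]_f`, with `[x, x]_f = f'(x)`. -/
noncomputable def divDiff₁ (f : ℝ → ℝ) (x y : ℝ) : ℝ :=
  if x = y then deriv f x else (f x - f y) / (x - y)

/-- The second divided difference `[x, y, z]_f`.  It is `([x, y]_f - [y, z]_f) / (x - z)` when
`x ≠ z`; the remaining cases are given by permutation invariance, `[x, y, x]_f = [x, x, y]_f`,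
when `x = z ≠ y`, and by `[x, x, x]_f = f''(x) / 2!`. -/
noncomputable def divDiff₂ (f : ℝ → ℝ) (x y z : ℝ) : ℝ :=
  if x ≠ z then (divDiff₁ f x y - divDiff₁ f y z) / (x - z)
  else if x ≠ y then (divDiff₁ f x x - divDiff₁ f x y) / (x - y)
  else iteratedDeriv 2 f x / (Nat.factorial 2 : ℝ)

/-!
For a `C²` function `f` and a real diagonal matrix `diag x`, the matrix function expands as
`f (diag x + h H) = f (diag x) + h L + h² Q + o(h²)`, where `L i j = [x i, x j]_f H i j` and
`Q i j = ∑ k, [x i, x k, x j]_f H i k H k j`. For polynomials this is the Leibniz rule for divided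
differences; in general one interpolates the second-order jets of `f` at the nodes by a polynomial,
and the remainder is `o(h²)` because every eigenvalue of `A + E` is within `‖E‖` of one of `A`.

The coefficient of `h` with `H` the all-ones matrix shows that `n`-monotonicity of `g` makes the
Loewner matrices `([x i, x j]_g)` positive semidefinite, and the coefficient of `h²` gives the Kraus
criterion: on an open interval, `n`-convexity means that all matrices `([x k, x i, x j]_f)` are
positive semidefinite. When `f t = t g t`, the Leibniz rule writes the Kraus matrix of `f` at `x k`
as `x k` times that of `g` plus the Loewner matrix of `g`, so it is positive semidefinite. The
endpoint `0` is reached by letting `ε ↓ 0` in `A + ε`.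
-/

open Filter Topology Asymptotics Polynomial
open scoped ComplexOrder MatrixOrder Matrix Matrix.Norms.L2Operator

/-! ### Divided differences -/

section DividedDifferences

variable {f g : ℝ → ℝ} {x y z : ℝ}

lemma divDiff₁_comm (f : ℝ → ℝ) (x y : ℝ) : divDiff₁ f x y = divDiff₁ f y x := by
  rcases eq_or_ne x y with rfl | hxy
  · rfl
  · rw [divDiff₁, divDiff₁, if_neg hxy, if_neg hxy.symm, ← neg_sub (f y), ← neg_sub y,
      neg_div_neg_eq]

lemma sub_mul_divDiff₁ (f : ℝ → ℝ) (x y : ℝ) : (x - y) * divDiff₁ f x y = f x - f y := by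
  rcases eq_or_ne x y with rfl | hxy
  · simp
  · rw [divDiff₁, if_neg hxy, mul_div_cancel₀ _ (sub_ne_zero.2 hxy)]

lemma sub_mul_divDiff₂ (f : ℝ → ℝ) (x y z : ℝ) :
    (x - z) * divDiff₂ f x y z = divDiff₁ f x y - divDiff₁ f y z := by
  rcases eq_or_ne x z with rfl | hxz
  · rw [sub_self, zero_mul, divDiff₁_comm f y x, sub_self]
  · rw [divDiff₂, if_pos hxz, mul_div_cancel₀ _ (sub_ne_zero.2 hxz)]

lemma sub_mul_divDiff₂_self (f : ℝ → ℝ) (x y : ℝ) :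
    (x - y) * divDiff₂ f x y x = divDiff₁ f x x - divDiff₁ f x y := by
  rcases eq_or_ne x y with rfl | hxy
  · simp
  · rw [divDiff₂, if_neg (not_not.2 rfl), if_pos hxy, mul_div_cancel₀ _ (sub_ne_zero.2 hxy)]

lemma divDiff₁_self (f : ℝ → ℝ) (x : ℝ) : divDiff₁ f x x = deriv f x := if_pos rfl

lemma divDiff₂_self (f : ℝ → ℝ) (x : ℝ) : divDiff₂ f x x x = iteratedDeriv 2 f x / 2 := by
  simp [divDiff₂]

lemma divDiff₂_swap (f : ℝ → ℝ) (x y z : ℝ) : divDiff₂ f x y z = divDiff₂ f y x z := by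
  rcases eq_or_ne x y with rfl | hxy
  · rfl
  rcases eq_or_ne x z with rfl | hxz
  · apply mul_left_cancel₀ (sub_ne_zero.2 hxy)
    linear_combination sub_mul_divDiff₂_self f x y + sub_mul_divDiff₂ f y x x + divDiff₁_comm f y x
  rcases eq_or_ne y z with rfl | hyz
  · apply mul_left_cancel₀ (sub_ne_zero.2 hxy)
    linear_combination sub_mul_divDiff₂ f x y y + sub_mul_divDiff₂_self f y x - divDiff₁_comm f y x
  · apply mul_left_cancel₀ (sub_ne_zero.2 hxz)
    apply mul_left_cancel₀ (sub_ne_zero.2 hyz)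
    apply mul_left_cancel₀ (sub_ne_zero.2 hxy)
    linear_combination (x - y) * (y - z) * sub_mul_divDiff₂ f x y z -
      (x - y) * (x - z) * sub_mul_divDiff₂ f y x z + (x - z) * (x - y) * divDiff₁_comm f x y +
      (y - z) * sub_mul_divDiff₁ f x y - (x - z) * sub_mul_divDiff₁ f x y +
      (x - y) * sub_mul_divDiff₁ f x z - (x - y) * sub_mul_divDiff₁ f y z

lemma divDiff₁_const (c x y : ℝ) : divDiff₁ (fun _ ↦ c) x y = 0 := by
  simp [divDiff₁]

lemma divDiff₂_const (c x y z : ℝ) : divDiff₂ (fun _ ↦ c) x y z = 0 := by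
  simp [divDiff₂, divDiff₁_const, iteratedDeriv_const]

lemma divDiff₁_id (x y : ℝ) : divDiff₁ (fun t ↦ t) x y = 1 := by
  rcases eq_or_ne x y with rfl | hxy
  · rw [divDiff₁_self, deriv_id'']
  · rw [divDiff₁, if_neg hxy, div_self (sub_ne_zero.2 hxy)]

lemma divDiff₂_id (x y z : ℝ) : divDiff₂ (fun t ↦ t) x y z = 0 := by
  simp [divDiff₂, divDiff₁_id, iteratedDeriv_succ]

lemma divDiff₁_add (hf : DifferentiableAt ℝ f x) (hg : DifferentiableAt ℝ g x) (y : ℝ) :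
    divDiff₁ (fun t ↦ f t + g t) x y = divDiff₁ f x y + divDiff₁ g x y := by
  rcases eq_or_ne x y with rfl | hxy
  · simp only [divDiff₁_self, deriv_fun_add hf hg]
  · simp only [divDiff₁, if_neg hxy]
    ring

lemma divDiff₂_add (hfx : ContDiffAt ℝ 2 f x) (hgx : ContDiffAt ℝ 2 g x)
    (hfy : DifferentiableAt ℝ f y) (hgy : DifferentiableAt ℝ g y) (z : ℝ) :
    divDiff₂ (fun t ↦ f t + g t) x y z = divDiff₂ f x y z + divDiff₂ g x y z := by
  have hfx' := hfx.differentiableAt two_ne_zero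
  have hgx' := hgx.differentiableAt two_ne_zero
  simp only [divDiff₂, divDiff₁_add hfx' hgx', divDiff₁_add hfy hgy,
    iteratedDeriv_fun_add hfx hgx]
  split_ifs <;> ring

lemma divDiff₁_mul (hf : DifferentiableAt ℝ f x) (hg : DifferentiableAt ℝ g x) (y : ℝ) :
    divDiff₁ (fun t ↦ f t * g t) x y = f x * divDiff₁ g x y + divDiff₁ f x y * g y := by
  rcases eq_or_ne x y with rfl | hxy
  · simp only [divDiff₁_self, deriv_fun_mul hf hg]
    ring
  · apply mul_left_cancel₀ (sub_ne_zero.2 hxy)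
    linear_combination sub_mul_divDiff₁ (fun t ↦ f t * g t) x y - f x * sub_mul_divDiff₁ g x y -
      g y * sub_mul_divDiff₁ f x y

theorem divDiff₂_mul (hfx : ContDiffAt ℝ 2 f x) (hgx : ContDiffAt ℝ 2 g x)
    (hfy : DifferentiableAt ℝ f y) (hgy : DifferentiableAt ℝ g y) (z : ℝ) :
    divDiff₂ (fun t ↦ f t * g t) x y z =
      f x * divDiff₂ g x y z + divDiff₁ f x y * divDiff₁ g y z + divDiff₂ f x y z * g z := by
  have hfx' := hfx.differentiableAt two_ne_zero
  have hgx' := hgx.differentiableAt two_ne_zero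
  rcases eq_or_ne x z with rfl | hxz
  · rcases eq_or_ne x y with rfl | hxy
    · simp only [divDiff₂_self, divDiff₁_self, iteratedDeriv_fun_mul hfx hgx,
        Finset.sum_range_succ, Finset.sum_range_zero, iteratedDeriv_zero, iteratedDeriv_one]
      norm_num
      ring
    · apply mul_left_cancel₀ (sub_ne_zero.2 hxy)
      linear_combination sub_mul_divDiff₂_self (fun t ↦ f t * g t) x y +
        divDiff₁_mul hfx' hgx' x - divDiff₁_mul hfx' hgx' y -
        f x * sub_mul_divDiff₂_self g x y - g x * sub_mul_divDiff₂_self f x y +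
        divDiff₁ f x y * sub_mul_divDiff₁ g y x
  · apply mul_left_cancel₀ (sub_ne_zero.2 hxz)
    linear_combination sub_mul_divDiff₂ (fun t ↦ f t * g t) x y z +
      divDiff₁_mul hfx' hgx' y - divDiff₁_mul hfy hgy z -
      f x * sub_mul_divDiff₂ g x y z - g z * sub_mul_divDiff₂ f x y z -
      divDiff₁ g y z * sub_mul_divDiff₁ f x y - divDiff₁ f x y * sub_mul_divDiff₁ g y z

lemma divDiff₂_id_mul (hx : ContDiffAt ℝ 2 g x) (hy : DifferentiableAt ℝ g y) (z : ℝ) :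
    divDiff₂ (fun t ↦ t * g t) x y z = x * divDiff₂ g x y z + divDiff₁ g y z := by
  rw [divDiff₂_mul contDiffAt_fun_id hx differentiableAt_fun_id hy, divDiff₁_id, divDiff₂_id,
    one_mul, zero_mul, add_zero]

/-- The second-order jet `(f(t), f'(t), f''(t))`: the data at `t` on which the divided
differences of order at most two depend. -/
noncomputable def twoJet (f : ℝ → ℝ) (t : ℝ) : ℝ × ℝ × ℝ :=
  (f t, deriv f t, iteratedDeriv 2 f t)

lemma twoJet_eq_iff {t : ℝ} : twoJet f t = twoJet g t ↔
    f t = g t ∧ deriv f t = deriv g t ∧ iteratedDeriv 2 f t = iteratedDeriv 2 g t := by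
  simp only [twoJet, Prod.mk.injEq]

lemma twoJet_congr {t : ℝ} (h : f =ᶠ[𝓝 t] g) : twoJet f t = twoJet g t :=
  twoJet_eq_iff.2 ⟨h.eq_of_nhds, h.deriv_eq, h.iteratedDeriv_eq 2⟩

lemma divDiff₁_congr (hx : twoJet f x = twoJet g x) (hy : twoJet f y = twoJet g y) :
    divDiff₁ f x y = divDiff₁ g x y := by
  rw [twoJet_eq_iff] at hx hy
  simp only [divDiff₁, hx, hy]

lemma divDiff₂_congr (hx : twoJet f x = twoJet g x) (hy : twoJet f y = twoJet g y)
    (hz : twoJet f z = twoJet g z) : divDiff₂ f x y z = divDiff₂ g x y z := by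
  simp only [divDiff₂, divDiff₁_congr hx hy, divDiff₁_congr hy hz, divDiff₁_congr hx hx,
    (twoJet_eq_iff.1 hx).2.2]

end DividedDifferences

section Interpolation

lemma exists_polynomial_forall_pow_dvd_sub {K : Type*} [Field K] (s : Finset K) (p : K → K[X])
    (n : ℕ) : ∃ q : K[X], ∀ t ∈ s, (X - C t) ^ n ∣ q - p t := by
  have hcoprime :
      Pairwise (Function.onFun IsCoprime fun t : s ↦ Ideal.span {(X - C t.1) ^ n}) := by
    intro t r htr
    rw [Function.onFun, Ideal.isCoprime_span_singleton_iff]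
    exact (isCoprime_X_sub_C_of_isUnit_sub
      (sub_ne_zero.2 (Subtype.coe_injective.ne htr)).isUnit).pow
  obtain ⟨q, hq⟩ := Ideal.exists_forall_sub_mem_ideal hcoprime fun t ↦ p t
  exact ⟨q, fun t ht ↦ Ideal.mem_span_singleton.1 (hq ⟨t, ht⟩)⟩

lemma twoJet_eval (p : ℝ[X]) (t : ℝ) :
    twoJet p.eval t = (p.eval t, p.derivative.eval t, p.derivative.derivative.eval t) := by
  have hderiv (q : ℝ[X]) : deriv q.eval = q.derivative.eval := funext fun _ ↦ q.deriv
  simp only [twoJet, iteratedDeriv_succ, iteratedDeriv_zero, hderiv]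

lemma exists_polynomial_twoJet_eq (s : Finset ℝ) (f : ℝ → ℝ) :
    ∃ p : ℝ[X], ∀ t ∈ s, twoJet p.eval t = twoJet f t := by
  obtain ⟨p, hp⟩ := exists_polynomial_forall_pow_dvd_sub s
    (fun t ↦ C (f t) + C (deriv f t) * (X - C t) + C (iteratedDeriv 2 f t / 2) * (X - C t) ^ 2) 3
  refine ⟨p, fun t ht ↦ ?_⟩
  obtain ⟨q, hq⟩ := hp t ht
  rw [twoJet_eval, sub_eq_iff_eq_add.1 hq]
  simp [derivative_pow, twoJet]

lemma isLittleO_sub_of_twoJet_eq {f g : ℝ → ℝ} {t : ℝ} (hf : ContDiffAt ℝ 2 f t)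
    (hg : ContDiffAt ℝ 2 g t) (hfg : twoJet f t = twoJet g t) :
    (fun y ↦ f y - g y) =o[𝓝 t] fun y ↦ (y - t) ^ 2 := by
  have hq : ContDiffAt ℝ 2 (fun y ↦ f y - g y) t := hf.sub hg
  obtain ⟨h₀, h₁, h₂⟩ := twoJet_eq_iff.1 hfg
  obtain ⟨r, hr, hball⟩ := Metric.eventually_nhds_iff_ball.1 (hq.eventually (by simp))
  have ht := Metric.mem_ball_self (x := t) hr
  have htaylor := taylor_isLittleO (n := 2) (convex_ball t r) ht fun y hy ↦
    (hball y hy).contDiffWithinAt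
  rw [Metric.isOpen_ball.nhdsWithin_eq ht] at htaylor
  refine htaylor.congr_left fun y ↦ ?_
  have hderiv : deriv (fun y ↦ f y - g y) t = 0 := by
    rw [deriv_fun_sub (hf.differentiableAt two_ne_zero) (hg.differentiableAt two_ne_zero), h₁,
      sub_self]
  have hderiv₂ : iteratedDeriv 2 (fun y ↦ f y - g y) t = 0 := by
    rw [iteratedDeriv_fun_sub hf hg, h₂, sub_self]
  simp [taylorWithinEval_succ, iteratedDerivWithin_of_isOpen Metric.isOpen_ball ht,
    iteratedDeriv_one, h₀, hderiv, hderiv₂]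

end Interpolation

/-! ### Second-order Peano expansions -/

section PeanoExpansion

variable {E F A : Type*} [NormedAddCommGroup E] [NormedSpace ℝ E] [NormedAddCommGroup F]
  [NormedSpace ℝ F] [NormedRing A] [NormedAlgebra ℝ A]

/-- `φ (s + h) = φ s + h • b + h ^ 2 • c + o(h ^ 2)` as `h → 0`. Unlike two-fold differentiability
at `s`, this gives no information on derivatives of `φ` at other points; `c` plays the role of half
the second derivative. -/
def HasPeanoExpansion (φ : ℝ → E) (s : ℝ) (b c : E) : Prop :=
  (fun h : ℝ ↦ φ (s + h) - (φ s + h • b + h ^ 2 • c)) =o[𝓝 0] fun h ↦ h ^ 2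

namespace HasPeanoExpansion

variable {φ ψ : ℝ → E} {s : ℝ} {b b' c c' : E}

lemma congr_of_shift {φ' : ℝ → E} {s' : ℝ} (hφ : HasPeanoExpansion φ s b c)
    (h : ∀ h, φ' (s' + h) = φ (s + h)) : HasPeanoExpansion φ' s' b c := by
  have h₀ : φ' s' = φ s := by simpa using h 0
  simpa only [HasPeanoExpansion, h, h₀] using hφ

lemma add (hφ : HasPeanoExpansion φ s b c) (hψ : HasPeanoExpansion ψ s b' c') :
    HasPeanoExpansion (fun t ↦ φ t + ψ t) s (b + b') (c + c') :=
  (IsLittleO.add hφ hψ).congr_left fun h ↦ by module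

lemma add_isLittleO (hφ : HasPeanoExpansion φ s b c)
    (hψ : (fun h ↦ ψ (s + h)) =o[𝓝 0] fun h ↦ h ^ 2) :
    HasPeanoExpansion (fun t ↦ φ t + ψ t) s b c := by
  have h₀ : ψ s = 0 := by simpa using hψ.isBigO.eq_zero_imp.self_of_nhds
  exact (IsLittleO.add hφ hψ).congr_left fun h ↦ by simp only [h₀]; module

lemma clm_comp (hφ : HasPeanoExpansion φ s b c) (L : E →L[ℝ] F) :
    HasPeanoExpansion (fun t ↦ L (φ t)) s (L b) (L c) :=
  ((L.isBigO_comp _ _).trans_isLittleO hφ).congr_left fun h ↦ by simp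

lemma hasDerivAt (hφ : HasPeanoExpansion φ s b c) : HasDerivAt φ b s := by
  rw [hasDerivAt_iff_isLittleO_nhds_zero]
  have hsq : (fun h : ℝ ↦ h ^ 2) =o[𝓝 0] fun h ↦ h := by
    simpa using isLittleO_pow_pow (𝕜 := ℝ) one_lt_two
  have hquad : (fun h : ℝ ↦ h ^ 2 • c) =o[𝓝 0] fun h ↦ h :=
    (IsBigO.of_bound ‖c‖ (.of_forall fun h ↦ by rw [norm_smul, mul_comm])).trans_isLittleO hsq
  exact ((IsLittleO.trans hφ hsq).add hquad).congr_left fun h ↦ by module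

lemma tendsto_second_difference (hφ : HasPeanoExpansion φ s b c) :
    Tendsto (fun h : ℝ ↦ (h ^ 2)⁻¹ • ((1 / 2 : ℝ) • φ (s + h) + (1 / 2 : ℝ) • φ (s - h) - φ s))
      (𝓝[≠] 0) (𝓝 c) := by
  have hneg : Tendsto (fun h : ℝ ↦ -h) (𝓝 0) (𝓝 0) :=
    continuous_neg.tendsto' 0 0 neg_zero
  have hφ' := (IsLittleO.comp_tendsto hφ hneg).congr_right fun h ↦ neg_sq h
  have hsum := ((IsLittleO.add hφ hφ').const_smul_left (1 / 2 : ℝ)).mono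
    (nhdsWithin_le_nhds (s := {0}ᶜ))
  rw [← tendsto_sub_nhds_zero_iff]
  refine hsum.tendsto_inv_smul_nhds_zero.congr' ?_
  filter_upwards [self_mem_nhdsWithin] with h (hh : h ≠ 0)
  simp only [Pi.smul_apply, Function.comp_apply, ← sub_eq_add_neg]
  match_scalars <;> field_simp <;> ring

lemma nonpos_of_isLocalMax {φ : ℝ → ℝ} {b c : ℝ} (hφ : HasPeanoExpansion φ s b c)
    (hmax : IsLocalMax φ s) : c ≤ 0 := by
  have hadd : Tendsto (fun h ↦ s + h) (𝓝 0) (𝓝 s) :=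
    (continuous_const_add s).tendsto' 0 s (add_zero s)
  have hsub : Tendsto (fun h ↦ s - h) (𝓝 0) (𝓝 s) :=
    (continuous_sub_left s).tendsto' 0 s (sub_zero s)
  refine le_of_tendsto hφ.tendsto_second_difference (nhdsWithin_le_nhds ?_)
  filter_upwards [hadd.eventually hmax, hsub.eventually hmax] with h hplus hminus
  rw [smul_eq_mul, smul_eq_mul, smul_eq_mul]
  exact mul_nonpos_of_nonneg_of_nonpos (by positivity) (by linarith)

lemma mul {φ ψ : ℝ → A} {b b' c c' : A} (hφ : HasPeanoExpansion φ s b c)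
    (hψ : HasPeanoExpansion ψ s b' c') :
    HasPeanoExpansion (fun t ↦ φ t * ψ t) s (φ s * b' + b * ψ s)
      (φ s * c' + b * b' + c * ψ s) := by
  have hψ_bdd : (fun h ↦ ψ (s + h)) =O[𝓝 0] fun _ ↦ (1 : ℝ) := by
    refine Tendsto.isBigO_one ℝ (c := ψ s) ?_
    exact hψ.hasDerivAt.continuousAt.tendsto.comp
      ((continuous_const_add s).tendsto' 0 s (add_zero s))
  have hφ_bdd : (fun h : ℝ ↦ φ s + h • b + h ^ 2 • c) =O[𝓝 0] fun _ ↦ (1 : ℝ) :=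
    (Continuous.tendsto (by fun_prop) 0).isBigO_one ℝ
  have hhigher : (fun h : ℝ ↦ h ^ 2 • (h • (b * c' + c * b') + h ^ 2 • (c * c'))) =o[𝓝 0]
      fun h ↦ h ^ 2 • (1 : ℝ) := by
    refine (isBigO_refl _ _).smul_isLittleO ((isLittleO_one_iff ℝ).2 ?_)
    exact Continuous.tendsto' (by fun_prop) 0 0 (by simp)
  have hleft := (IsLittleO.mul_isBigO hφ hψ_bdd).congr_right fun h ↦ mul_one (h ^ 2)
  have hright := (hφ_bdd.mul_isLittleO hψ).congr_right fun h ↦ one_mul (h ^ 2)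
  refine ((hleft.add hright).add (hhigher.congr_right fun h ↦ mul_one (h ^ 2))).congr_left
    fun h ↦ ?_
  simp only [sub_mul, mul_sub, add_mul, mul_add, smul_mul_assoc, mul_smul_comm]
  module

end HasPeanoExpansion

lemma hasPeanoExpansion_quadratic (a b c s : ℝ) :
    HasPeanoExpansion (fun t ↦ a + b * t + c * t ^ 2) s (b + 2 * c * s) c :=
  (isLittleO_zero _ _).congr_left fun h ↦ by simp only [smul_eq_mul]; ring

lemma hasPeanoExpansion_add_smul (a b : E) : HasPeanoExpansion (fun t : ℝ ↦ a + t • b) 0 b 0 :=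
  (isLittleO_zero _ _).congr_left fun h ↦ by module

lemma le_max_of_hasPeanoExpansion {φ : ℝ → ℝ} {x y : ℝ}
    (hφ : ∀ s ∈ Set.Icc x y, ∃ b c, 0 < c ∧ HasPeanoExpansion φ s b c) {t : ℝ}
    (ht : t ∈ Set.Icc x y) : φ t ≤ max (φ x) (φ y) := by
  have hcont : ContinuousOn φ (Set.Icc x y) := fun s hs ↦
    let ⟨_, _, _, h⟩ := hφ s hs
    h.hasDerivAt.continuousAt.continuousWithinAt
  obtain ⟨s, hs, hmax⟩ := isCompact_Icc.exists_isMaxOn ⟨t, ht⟩ hcont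
  refine (hmax ht).trans ?_
  rcases hs.1.eq_or_lt with rfl | hxs
  · exact le_max_left _ _
  rcases hs.2.eq_or_lt with rfl | hsy
  · exact le_max_right _ _
  obtain ⟨b, c, hc, h⟩ := hφ s hs
  exact absurd (h.nonpos_of_isLocalMax (hmax.isLocalMax (Icc_mem_nhds hxs hsy))) hc.not_ge

theorem convexOn_of_hasPeanoExpansion {φ : ℝ → ℝ} {S : Set ℝ} (hS : Convex ℝ S)
    (hφ : ∀ s ∈ S, ∃ b c, 0 ≤ c ∧ HasPeanoExpansion φ s b c) : ConvexOn ℝ S φ := by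
  refine LinearOrder.convexOn_of_lt hS fun x hx y hy hxy p q hp hq hpq ↦ ?_
  obtain rfl : p = 1 - q := by linarith
  simp only [smul_eq_mul]
  set t := (1 - q) * x + q * y with ht
  have hyx : 0 < y - x := sub_pos.2 hxy
  have hxt : t - x = q * (y - x) := by rw [ht]; ring
  have hyt : y - t = (1 - q) * (y - x) := by rw [ht]; ring
  have hK : 0 < (t - x) * (y - t) := by rw [hxt, hyt]; positivity
  have htxy : t ∈ Set.Icc x y := ⟨by nlinarith, by nlinarith⟩
  refine le_of_forall_pos_le_add fun δ hδ ↦ ?_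
  obtain ⟨ε, hε, hεδ⟩ : ∃ ε, 0 < ε ∧ ε * ((t - x) * (y - t)) = δ :=
    ⟨_, div_pos hδ hK, div_mul_cancel₀ δ hK.ne'⟩
  obtain ⟨m, hm⟩ : ∃ m, m * (y - x) = φ y - φ x := ⟨_, div_mul_cancel₀ _ hyx.ne'⟩
  -- Minus the chord of `φ`, plus `ε (r - x) (r - y)`, which makes the expansions strictly convex.
  set ρ : ℝ → ℝ := fun r ↦ m * x + ε * (x * y) - φ x + (-m - ε * (x + y)) * r + ε * r ^ 2 with hρ
  have hmax : φ t + ρ t ≤ max (φ x + ρ x) (φ y + ρ y) := by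
    refine le_max_of_hasPeanoExpansion (φ := fun r ↦ φ r + ρ r) (fun r hr ↦ ?_) htxy
    obtain ⟨b, c, hc, h⟩ := hφ r (hS.ordConnected.out hx hy hr)
    exact ⟨_, _, add_pos_of_nonneg_of_pos hc hε, h.add (hasPeanoExpansion_quadratic _ _ _ r)⟩
  have hρx : φ x + ρ x = 0 := by simp only [hρ]; ring
  have hρy : φ y + ρ y = 0 := by simp only [hρ]; linear_combination -hm
  have hρt : ρ t = -((1 - q) * φ x + q * φ y) - δ := by
    simp only [hρ]
    linear_combination -m * hxt - q * hm - hεδ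
  rw [hρx, hρy, max_self, hρt] at hmax
  linarith

end PeanoExpansion

/-! ### Spectra and functional calculus -/

lemma exists_subset_Icc_subset_of_isCompact {K S : Set ℝ} (hK : IsCompact K) (hKS : K ⊆ S)
    (hS : S.OrdConnected) : ∃ l u, K ⊆ Set.Icc l u ∧ Set.Icc l u ⊆ S := by
  rcases K.eq_empty_or_nonempty with rfl | hne
  · exact ⟨1, 0, by simp⟩
  · exact ⟨sInf K, sSup K, subset_Icc_csInf_csSup hK.bddBelow hK.bddAbove,
      hS.out (hKS (hK.sInf_mem hne)) (hKS (hK.sSup_mem hne))⟩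

section CStarAlgebra

variable {A : Type*} [CStarAlgebra A] {a b : A}

lemma exists_mem_spectrum_abs_sub_le (ha : IsSelfAdjoint a) {μ : ℝ}
    (hμ : μ ∈ spectrum ℝ (a + b)) : ∃ l ∈ spectrum ℝ a, |μ - l| ≤ ‖b‖ := by
  by_contra! hfar
  have hne (l : ℝ) (hl : l ∈ spectrum ℝ a) : l - μ ≠ 0 := by
    rw [← neg_sub, neg_ne_zero, ← abs_pos]
    exact (norm_nonneg b).trans_lt (hfar l hl)
  set r : ℝ → ℝ := fun l ↦ (l - μ)⁻¹ with hr
  have hr_cont : ContinuousOn r (spectrum ℝ a) := ContinuousOn.inv₀ (by fun_prop) hne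
  have hshift : cfc (fun l ↦ l - μ) a = a - algebraMap ℝ A μ := by
    rw [cfc_sub .., cfc_id' ℝ a, cfc_const μ a]
  have hinv : (a - algebraMap ℝ A μ) * cfc r a = 1 := by
    rw [← hshift, ← cfc_mul .., cfc_congr (g := fun _ ↦ 1) fun l hl ↦ mul_inv_cancel₀ (hne l hl),
      cfc_const_one ℝ a]
  have hsmall : ‖cfc r a * b‖ < 1 := by
    rcases eq_or_ne b 0 with rfl | hb
    · simp
    have hb : 0 < ‖b‖ := norm_pos_iff.2 hb
    have hcfc : ‖cfc r a‖ < ‖b‖⁻¹ := norm_cfc_lt (inv_pos.2 hb) fun l hl ↦ by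
      rw [norm_inv, Real.norm_eq_abs, abs_sub_comm]
      exact inv_strictAnti₀ hb (hfar l hl)
    calc ‖cfc r a * b‖ ≤ ‖cfc r a‖ * ‖b‖ := norm_mul_le _ _
      _ < ‖b‖⁻¹ * ‖b‖ := by gcongr
      _ = 1 := inv_mul_cancel₀ hb.ne'
  have hfactor : a + b - algebraMap ℝ A μ = (a - algebraMap ℝ A μ) * (1 - -(cfc r a * b)) := by
    rw [sub_neg_eq_add, mul_add, mul_one, ← mul_assoc, hinv, one_mul]
    abel
  rw [spectrum.mem_iff, ← neg_sub, IsUnit.neg_iff, hfactor] at hμ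
  have hunit : IsUnit (a - algebraMap ℝ A μ) := hshift ▸ (isUnit_cfc_iff _ a).2 hne
  exact hμ (hunit.mul (isUnit_one_sub_of_norm_lt_one (by rwa [norm_neg])))

lemma isSelfAdjoint_add_smul (ha : IsSelfAdjoint a) (hb : IsSelfAdjoint b) (h : ℝ) :
    IsSelfAdjoint (a + h • b) :=
  ha.add ((IsSelfAdjoint.all h).smul hb)

theorem isLittleO_cfc_add_smul (ha : IsSelfAdjoint a) (b : A) (hfin : (spectrum ℝ a).Finite)
    {q : ℝ → ℝ} {k : ℕ} (hq : ∀ l ∈ spectrum ℝ a, q =o[𝓝 l] fun y ↦ (y - l) ^ k) :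
    (fun h : ℝ ↦ cfc q (a + h • b)) =o[𝓝 0] fun h ↦ h ^ k := by
  refine IsLittleO.of_bound fun ε hε ↦ ?_
  set M := ‖b‖ ^ k + 1
  have hMpos : 0 < M := by positivity
  have hnear : ∀ᶠ δ in 𝓝 (0 : ℝ), ∀ l ∈ spectrum ℝ a, ∀ μ, |μ - l| ≤ δ →
      ‖q μ‖ ≤ ε / M * ‖(μ - l) ^ k‖ := by
    rw [eventually_all_finite hfin]
    intro l hl
    obtain ⟨δ, hδ, hball⟩ := Metric.eventually_nhds_iff.1 ((hq l hl).bound (div_pos hε hMpos))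
    filter_upwards [gt_mem_nhds hδ] with δ' hδ' μ hμ
    exact hball (hμ.trans_lt hδ')
  have hnorm : Tendsto (fun h : ℝ ↦ ‖h • b‖) (𝓝 0) (𝓝 0) :=
    Continuous.tendsto' (by fun_prop) 0 0 (by simp)
  filter_upwards [hnorm.eventually hnear] with h hh
  refine norm_cfc_le (by positivity) fun μ hμ ↦ ?_
  obtain ⟨l, hl, hlμ⟩ := exists_mem_spectrum_abs_sub_le ha hμ
  calc ‖q μ‖ ≤ ε / M * ‖(μ - l) ^ k‖ := hh l hl μ hlμ
    _ ≤ ε / M * (‖h ^ k‖ * ‖b‖ ^ k) := by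
        rw [norm_pow, norm_pow, ← mul_pow, Real.norm_eq_abs, ← norm_smul]
        gcongr
    _ ≤ ε / M * (‖h ^ k‖ * M) := by gcongr; exact (lt_add_one _).le
    _ = ε * ‖h ^ k‖ := by field_simp

lemma eventually_spectrum_add_smul_subset (a b : A) {U : Set ℝ} (hU : IsOpen U)
    (ha : spectrum ℝ a ⊆ U) : ∀ᶠ h in 𝓝 (0 : ℝ), spectrum ℝ (a + h • b) ⊆ U := by
  have hline : Tendsto (fun h : ℝ ↦ a + h • b) (𝓝 0) (𝓝 a) :=
    Continuous.tendsto' (by fun_prop) 0 a (by simp)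
  have := hline.eventually (upperHemicontinuous_spectrum ℝ A a U (hU.mem_nhdsSet.2 ha))
  filter_upwards [this] with h hh
  exact subset_of_mem_nhdsSet hh

lemma spectrum_add_algebraMap_subset {s t : Set ℝ} {ε : ℝ} (ha : spectrum ℝ a ⊆ s)
    (hst : ∀ l ∈ s, l + ε ∈ t) : spectrum ℝ (a + algebraMap ℝ A ε) ⊆ t := by
  intro μ hμ
  rw [← sub_add_cancel μ ε, add_comm a, spectrum.add_mem_add_iff] at hμ
  simpa using hst _ (ha hμ)

lemma cfc_add_algebraMap (ha : IsSelfAdjoint a) (ε : ℝ) {f : ℝ → ℝ}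
    (hf : ContinuousOn f ((fun t ↦ t + ε) '' spectrum ℝ a)) :
    cfc f (a + algebraMap ℝ A ε) = cfc (fun t ↦ f (t + ε)) a := by
  rw [cfc_comp' f (fun t ↦ t + ε) a, cfc_add_const ε (fun t ↦ t) a, cfc_id' ℝ a]

lemma tendsto_cfc_add_algebraMap (ha : IsSelfAdjoint a) (hfin : (spectrum ℝ a).Finite)
    {f : ℝ → ℝ} {l : Filter ℝ}
    (hf : ∀ t ∈ spectrum ℝ a, Tendsto (fun ε ↦ f (t + ε)) l (𝓝 (f t))) :
    Tendsto (fun ε : ℝ ↦ cfc f (a + algebraMap ℝ A ε)) l (𝓝 (cfc f a)) := by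
  have hshift (ε : ℝ) : cfc f (a + algebraMap ℝ A ε) = cfc (fun t ↦ f (t + ε)) a :=
    cfc_add_algebraMap ha ε ((hfin.image _).continuousOn f)
  simp only [hshift]
  refine tendsto_cfc_fun (fun V hV ↦ ?_) (.of_forall fun ε ↦ hfin.continuousOn _)
  rw [eventually_all_finite hfin]
  exact fun t ht ↦ Uniform.tendsto_nhds_right.1 (hf t ht) hV

variable [PartialOrder A] [StarOrderedRing A]

lemma spectrum_subset_Icc_iff (ha : IsSelfAdjoint a) {l u : ℝ} :
    spectrum ℝ a ⊆ Set.Icc l u ↔ a ∈ Set.Icc (algebraMap ℝ A l) (algebraMap ℝ A u) := by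
  rw [Set.mem_Icc, algebraMap_le_iff_le_spectrum, le_algebraMap_iff_spectrum_le]
  exact forall₂_and

lemma spectrum_convex_comb_subset (ha : IsSelfAdjoint a) (hb : IsSelfAdjoint b) {S : Set ℝ}
    (hS : S.OrdConnected) (haS : spectrum ℝ a ⊆ S) (hbS : spectrum ℝ b ⊆ S) {p q : ℝ}
    (hp : 0 ≤ p) (hq : 0 ≤ q) (hpq : p + q = 1) : spectrum ℝ (p • a + q • b) ⊆ S := by
  obtain ⟨l, u, hK, hIcc⟩ := exists_subset_Icc_subset_of_isCompact
    ((spectrum.isCompact a).union (spectrum.isCompact b)) (Set.union_subset haS hbS) hS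
  obtain ⟨hal, hbl⟩ := Set.union_subset_iff.1 hK
  rw [spectrum_subset_Icc_iff ha] at hal
  rw [spectrum_subset_Icc_iff hb] at hbl
  have hself : IsSelfAdjoint (p • a + q • b) :=
    ((IsSelfAdjoint.all p).smul ha).add ((IsSelfAdjoint.all q).smul hb)
  exact ((spectrum_subset_Icc_iff hself).2 (convex_Icc _ _ hal hbl hp hq hpq)).trans hIcc

end CStarAlgebra

/-! ### Second-order expansion of the matrix functional calculus -/

section MatrixExpansion

variable {ι : Type*} {f g : ℝ → ℝ} {x : ι → ℝ}

/-- The Loewner matrix `([x i, x j]_f)` of `f` at the nodes `x`. -/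
noncomputable def loewnerMatrix (f : ℝ → ℝ) (x : ι → ℝ) : Matrix ι ι ℂ :=
  Matrix.of fun i j ↦ (divDiff₁ f (x i) (x j) : ℂ)

/-- The Kraus matrix `([x k, x i, x j]_f)` of `f` at the nodes `x`, based at the `k`-th node. -/
noncomputable def krausMatrix (f : ℝ → ℝ) (x : ι → ℝ) (k : ι) : Matrix ι ι ℂ :=
  Matrix.of fun i j ↦ (divDiff₂ f (x k) (x i) (x j) : ℂ)

/-- The coefficient of `h ^ 2` in the expansion of `f (diag x + h H)`: half the second
derivative of the matrix function `f` at `diag x` in the direction `H`. -/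
noncomputable def krausQuadratic [Fintype ι] (f : ℝ → ℝ) (x : ι → ℝ) (H : Matrix ι ι ℂ) :
    Matrix ι ι ℂ :=
  Matrix.of fun i j ↦ ∑ k, (divDiff₂ f (x i) (x k) (x j) : ℂ) * (H i k * H k j)

lemma loewnerMatrix_congr (hfg : ∀ i, twoJet f (x i) = twoJet g (x i)) :
    loewnerMatrix f x = loewnerMatrix g x := by
  ext i j
  simp only [loewnerMatrix, Matrix.of_apply, divDiff₁_congr (hfg i) (hfg j)]

lemma krausQuadratic_congr [Fintype ι] (hfg : ∀ i, twoJet f (x i) = twoJet g (x i))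
    (H : Matrix ι ι ℂ) : krausQuadratic f x H = krausQuadratic g x H := by
  ext i j
  simp only [krausQuadratic, Matrix.of_apply, divDiff₂_congr (hfg i) (hfg _) (hfg j)]

lemma loewnerMatrix_add (hf : ∀ i, DifferentiableAt ℝ f (x i))
    (hg : ∀ i, DifferentiableAt ℝ g (x i)) :
    loewnerMatrix (fun t ↦ f t + g t) x = loewnerMatrix f x + loewnerMatrix g x := by
  ext i j
  simp [loewnerMatrix, divDiff₁_add (hf i) (hg i)]

lemma krausQuadratic_add [Fintype ι] (hf : ∀ i, ContDiffAt ℝ 2 f (x i))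
    (hg : ∀ i, ContDiffAt ℝ 2 g (x i)) (H : Matrix ι ι ℂ) :
    krausQuadratic (fun t ↦ f t + g t) x H = krausQuadratic f x H + krausQuadratic g x H := by
  ext i j
  simp [krausQuadratic, ← Finset.sum_add_distrib, ← add_mul, divDiff₂_add (hf i) (hg i)
    ((hf _).differentiableAt two_ne_zero) ((hg _).differentiableAt two_ne_zero)]

variable [DecidableEq ι]

lemma isSelfAdjoint_diagonal_ofReal (x : ι → ℝ) :
    IsSelfAdjoint (Matrix.diagonal fun i ↦ (x i : ℂ)) := by
  rw [← Matrix.isHermitian_iff_isSelfAdjoint]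
  exact Matrix.isHermitian_diagonal_of_self_adjoint _ (funext fun i ↦ Complex.conj_ofReal (x i))

variable [Fintype ι]

lemma loewnerMatrix_mul_id_hadamard (hf : ∀ i, DifferentiableAt ℝ f (x i)) (H : Matrix ι ι ℂ) :
    loewnerMatrix (fun t ↦ f t * t) x ⊙ H = Matrix.diagonal (fun i ↦ (f (x i) : ℂ)) * H +
      (loewnerMatrix f x ⊙ H) * Matrix.diagonal fun i ↦ (x i : ℂ) := by
  ext i j
  simp only [loewnerMatrix, Matrix.hadamard_apply, Matrix.of_apply, Matrix.add_apply,
    Matrix.diagonal_mul, Matrix.mul_diagonal, divDiff₁_mul (hf i) differentiableAt_fun_id,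
    divDiff₁_id]
  push_cast
  ring

lemma krausQuadratic_mul_id (hf : ∀ i, ContDiffAt ℝ 2 f (x i)) (H : Matrix ι ι ℂ) :
    krausQuadratic (fun t ↦ f t * t) x H = (loewnerMatrix f x ⊙ H) * H +
      krausQuadratic f x H * Matrix.diagonal fun i ↦ (x i : ℂ) := by
  ext i j
  rw [Matrix.add_apply, Matrix.mul_diagonal]
  simp only [loewnerMatrix, krausQuadratic, Matrix.of_apply, Matrix.mul_apply,
    Matrix.hadamard_apply, Finset.sum_mul, ← Finset.sum_add_distrib, divDiff₁_id, divDiff₂_id,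
    divDiff₂_mul (hf i) contDiffAt_fun_id ((hf _).differentiableAt two_ne_zero)
      differentiableAt_fun_id]
  refine Finset.sum_congr rfl fun k _ ↦ ?_
  push_cast
  ring

lemma spectrum_diagonal_ofReal (x : ι → ℝ) :
    spectrum ℝ (Matrix.diagonal fun i ↦ (x i : ℂ)) = Set.range x := by
  ext l
  rw [← spectrum.algebraMap_mem_iff ℂ, spectrum_diagonal]
  simp

lemma spectrum_diagonal_ofReal_subset {U : Set ℝ} (hx : ∀ i, x i ∈ U) :
    spectrum ℝ (Matrix.diagonal fun i ↦ (x i : ℂ)) ⊆ U :=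
  (spectrum_diagonal_ofReal x).trans_subset (Set.range_subset_iff.2 hx)

lemma krausQuadratic_eq_sum (f : ℝ → ℝ) (x : ι → ℝ) {H : Matrix ι ι ℂ} (hH : IsSelfAdjoint H) :
    krausQuadratic f x H =
      ∑ k, star (Matrix.diagonal (H k)) * krausMatrix f x k * Matrix.diagonal (H k) := by
  ext i j
  rw [Matrix.sum_apply]
  refine Finset.sum_congr rfl fun k _ ↦ ?_
  rw [Matrix.star_eq_conjTranspose, Matrix.diagonal_conjTranspose, Matrix.mul_diagonal,
    Matrix.diagonal_mul, krausMatrix, Matrix.of_apply, divDiff₂_swap, Pi.star_apply,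
    (Matrix.isHermitian_iff_isSelfAdjoint.2 hH).apply]
  ring

lemma krausQuadratic_vecMulVec_ofReal (f : ℝ → ℝ) (x u : ι → ℝ) :
    krausQuadratic f x (Matrix.vecMulVec (fun i ↦ (u i : ℂ)) fun i ↦ (u i : ℂ)) =
      star (Matrix.diagonal fun i ↦ (u i : ℂ)) * (∑ k, u k ^ 2 • krausMatrix f x k) *
        Matrix.diagonal fun i ↦ (u i : ℂ) := by
  ext i j
  rw [Matrix.star_eq_conjTranspose, Matrix.diagonal_conjTranspose, Matrix.mul_diagonal,
    Matrix.diagonal_mul, Matrix.sum_apply, Finset.mul_sum, Finset.sum_mul]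
  refine Finset.sum_congr rfl fun k _ ↦ ?_
  simp [krausMatrix, Matrix.vecMulVec_apply, divDiff₂_swap f (x i)]
  ring

lemma aeval_diagonal {R A : Type*} [CommSemiring R] [Semiring A] [Algebra R A] (d : ι → A)
    (p : R[X]) : aeval (Matrix.diagonal d) p = Matrix.diagonal fun i ↦ aeval (d i) p := by
  rw [← Matrix.diagonalAlgHom_apply (R := R), aeval_algHom_apply, aeval_pi_apply,
    Matrix.diagonalAlgHom_apply]

lemma contDiffAt_eval (p : ℝ[X]) (t : ℝ) : ContDiffAt ℝ 2 p.eval t := by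
  simpa using! (p.contDiff_aeval 2).contDiffAt (x := t)

theorem hasPeanoExpansion_aeval_diagonal_add_smul (x : ι → ℝ) (H : Matrix ι ι ℂ) (p : ℝ[X]) :
    HasPeanoExpansion (fun h : ℝ ↦ aeval (Matrix.diagonal (fun i ↦ (x i : ℂ)) + h • H) p) 0
      (loewnerMatrix p.eval x ⊙ H) (krausQuadratic p.eval x H) := by
  induction p using Polynomial.induction_on with
  | C a =>
    refine IsLittleO.congr_left (isLittleO_zero _ _) fun h ↦ ?_
    ext i j
    simp [loewnerMatrix, krausQuadratic, divDiff₁_const, divDiff₂_const]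
  | add p q hp hq =>
    have heval : (p + q).eval = fun t ↦ p.eval t + q.eval t := funext fun _ ↦ eval_add
    rw [heval, loewnerMatrix_add (fun i ↦ p.differentiableAt) (fun i ↦ q.differentiableAt),
      krausQuadratic_add (fun i ↦ contDiffAt_eval p _) (fun i ↦ contDiffAt_eval q _),
      Matrix.add_hadamard]
    simpa only [map_add] using hp.add hq
  | monomial n a hp =>
    rw [pow_succ, ← mul_assoc]
    set p := C a * X ^ n
    have heval : (p * X).eval = fun t ↦ p.eval t * t := funext fun _ ↦ eval_mul_X
    have h₀ : aeval (Matrix.diagonal fun i ↦ (x i : ℂ)) p =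
        Matrix.diagonal fun i ↦ ((p.eval (x i) : ℝ) : ℂ) := by
      rw [aeval_diagonal]
      simp only [← Complex.coe_algebraMap, aeval_algebraMap_apply, coe_aeval_eq_eval]
    rw [heval, loewnerMatrix_mul_id_hadamard (fun i ↦ p.differentiableAt),
      krausQuadratic_mul_id (fun i ↦ contDiffAt_eval p _)]
    simpa only [map_mul, aeval_X, zero_smul, add_zero, mul_zero, zero_add, h₀] using
      hp.mul (hasPeanoExpansion_add_smul (Matrix.diagonal fun i ↦ (x i : ℂ)) H)

theorem hasPeanoExpansion_cfc_diagonal_add_smul {H : Matrix ι ι ℂ} (hH : IsSelfAdjoint H)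
    (hf : ∀ i, ContDiffAt ℝ 2 f (x i)) :
    HasPeanoExpansion (fun h : ℝ ↦ cfc f (Matrix.diagonal (fun i ↦ (x i : ℂ)) + h • H)) 0
      (loewnerMatrix f x ⊙ H) (krausQuadratic f x H) := by
  have hD := isSelfAdjoint_diagonal_ofReal x
  obtain ⟨p, hp⟩ := exists_polynomial_twoJet_eq (Finset.univ.image x) f
  have hjet (i : ι) : twoJet p.eval (x i) = twoJet f (x i) :=
    hp _ (Finset.mem_image_of_mem x (Finset.mem_univ i))
  have hremainder := isLittleO_cfc_add_smul hD H Matrix.finite_real_spectrum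
    (q := fun t ↦ f t - p.eval t) (k := 2) (by
      rw [spectrum_diagonal_ofReal]
      rintro - ⟨i, rfl⟩
      exact isLittleO_sub_of_twoJet_eq (hf i) (contDiffAt_eval p _) (hjet i).symm)
  have hsum := (hasPeanoExpansion_aeval_diagonal_add_smul x H p).add_isLittleO
    (ψ := fun h ↦ cfc (fun t ↦ f t - p.eval t) (Matrix.diagonal (fun i ↦ (x i : ℂ)) + h • H))
    (by simpa only [zero_add] using hremainder)
  rw [loewnerMatrix_congr hjet, krausQuadratic_congr hjet] at hsum
  refine hsum.congr_of_shift fun h ↦ ?_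
  set B := Matrix.diagonal (fun i ↦ (x i : ℂ)) + (0 + h) • H
  have hB : IsSelfAdjoint B := isSelfAdjoint_add_smul hD hH _
  rw [cfc_sub _ _ B (B.finite_real_spectrum.continuousOn f) (B.finite_real_spectrum.continuousOn _),
    cfc_polynomial p B, add_sub_cancel]

theorem exists_nonneg_hasPeanoExpansion_cfc_add_smul {X H : Matrix ι ι ℂ} (hX : X.IsHermitian)
    (hH : IsSelfAdjoint H) (hf : ∀ i, ContDiffAt ℝ 2 f (hX.eigenvalues i))
    (hK : ∀ k, (krausMatrix f hX.eigenvalues k).PosSemidef) :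
    ∃ b c, 0 ≤ c ∧ HasPeanoExpansion (fun h : ℝ ↦ cfc f (X + h • H)) 0 b c := by
  set V := hX.eigenvectorUnitary
  set Φ := Unitary.conjStarAlgAut ℝ (Matrix ι ι ℂ) V
  set D := Matrix.diagonal fun i ↦ (hX.eigenvalues i : ℂ)
  have hD : IsSelfAdjoint D := isSelfAdjoint_diagonal_ofReal hX.eigenvalues
  have hΦD : Φ D = X := hX.spectral_theorem.symm
  have hH' : IsSelfAdjoint (Φ.symm H) := hH.map Φ.symm
  have hΦ_cont : Continuous Φ :=
    LinearMap.continuous_of_finiteDimensional Φ.toAlgEquiv.toLinearMap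
  have hexp := (hasPeanoExpansion_cfc_diagonal_add_smul hH' hf).clm_comp
    ⟨Φ.toAlgEquiv.toLinearMap, hΦ_cont⟩
  refine ⟨_, _, ?_, hexp.congr_of_shift fun h ↦ ?_⟩
  · rw [krausQuadratic_eq_sum f _ hH']
    exact star_right_conjugate_nonneg (Finset.sum_nonneg fun k _ ↦
      star_left_conjugate_nonneg (hK k).nonneg _) (V : Matrix ι ι ℂ)
  · have hself := isSelfAdjoint_add_smul hD hH' (0 + h)
    have hline : Φ (D + (0 + h) • Φ.symm H) = X + (0 + h) • H := by
      rw [map_add, map_smul, hΦD, Φ.apply_symm_apply]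
    rw [← hline]
    exact (StarAlgHomClass.map_cfc Φ f _ (Matrix.finite_real_spectrum.continuousOn f) hΦ_cont
      hself (hself.map Φ)).symm

end MatrixExpansion

/-! ### Divided-difference criteria -/

section QuadraticForm

variable {ι : Type*} [Fintype ι]

/-- The functional `M ↦ Re (wᴴ M w)` on complex matrices, real-linear so that it reduces matrix
inequalities along a real line to scalar ones. -/
noncomputable def reQuadForm (w : ι → ℂ) : Matrix ι ι ℂ →ₗ[ℝ] ℝ where
  toFun M := (star w ⬝ᵥ M *ᵥ w).re
  map_add' M N := by simp [Matrix.add_mulVec]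
  map_smul' c M := by simp [Matrix.smul_mulVec]

lemma reQuadForm_nonneg {M : Matrix ι ι ℂ} (hM : 0 ≤ M) (w : ι → ℂ) : 0 ≤ reQuadForm w M :=
  (Matrix.nonneg_iff_posSemidef.1 hM).re_dotProduct_nonneg w

lemma le_of_reQuadForm_le {M N : Matrix ι ι ℂ} (hM : IsSelfAdjoint M) (hN : IsSelfAdjoint N)
    (h : ∀ w, reQuadForm w M ≤ reQuadForm w N) : M ≤ N := by
  have hNM : (N - M).IsHermitian := hN.sub hM
  refine Matrix.le_iff.2 (.of_dotProduct_mulVec_nonneg hNM fun w ↦ ?_)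
  refine Complex.nonneg_iff.2 ⟨?_, (hNM.im_star_dotProduct_mulVec_self w).symm⟩
  exact (sub_nonneg.2 (h w)).trans_eq (map_sub (reQuadForm w) N M).symm

end QuadraticForm

section Criteria

variable {n : ℕ} {U : Set ℝ} {f g : ℝ → ℝ} {x : Fin n → ℝ}

theorem MatrixMonotoneOn.posSemidef_loewnerMatrix (hmono : MatrixMonotoneOn n U f) (hU : IsOpen U)
    (hf : ∀ t ∈ U, ContDiffAt ℝ 2 f t) (hx : ∀ i, x i ∈ U) : (loewnerMatrix f x).PosSemidef := by
  set D := Matrix.diagonal fun i ↦ (x i : ℂ)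
  have hD : IsSelfAdjoint D := isSelfAdjoint_diagonal_ofReal x
  set J : Matrix (Fin n) (Fin n) ℂ := Matrix.vecMulVec 1 (star 1)
  have hJ : J.PosSemidef := Matrix.posSemidef_vecMulVec_self_star 1
  have hderiv := (hasPeanoExpansion_cfc_diagonal_add_smul hJ.1 fun i ↦ hf _ (hx i)).hasDerivAt
  have hadamard_J : loewnerMatrix f x ⊙ J = loewnerMatrix f x := by
    ext i j
    simp [J]
  rw [← Matrix.nonneg_iff_posSemidef, ← hadamard_J]
  refine ge_of_tendsto hderiv.tendsto_slope_zero_right ?_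
  have hspec := eventually_spectrum_add_smul_subset D J hU (spectrum_diagonal_ofReal_subset hx)
  filter_upwards [self_mem_nhdsWithin, nhdsWithin_le_nhds hspec] with h (hh : 0 < h) hs
  rw [zero_add]
  refine smul_nonneg (inv_pos.2 hh).le (sub_nonneg.2 ?_)
  refine hmono _ _ (isSelfAdjoint_add_smul hD hJ.1 0) (isSelfAdjoint_add_smul hD hJ.1 h)
    hspec.self_of_nhds hs ?_
  gcongr
  exact hJ.nonneg

lemma MatrixConvexOn.krausQuadratic_nonneg (hconv : MatrixConvexOn n U f) (hU : IsOpen U)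
    (hf : ∀ t ∈ U, ContDiffAt ℝ 2 f t) (hx : ∀ i, x i ∈ U) {H : Matrix (Fin n) (Fin n) ℂ}
    (hH : IsSelfAdjoint H) : 0 ≤ krausQuadratic f x H := by
  set D := Matrix.diagonal fun i ↦ (x i : ℂ)
  have hD : IsSelfAdjoint D := isSelfAdjoint_diagonal_ofReal x
  refine ge_of_tendsto (hasPeanoExpansion_cfc_diagonal_add_smul hH
    fun i ↦ hf _ (hx i)).tendsto_second_difference ?_
  have hspec := eventually_spectrum_add_smul_subset D H hU (spectrum_diagonal_ofReal_subset hx)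
  have hneg : Tendsto (fun h : ℝ ↦ 0 - h) (𝓝 0) (𝓝 0) :=
    (continuous_sub_left 0).tendsto' 0 0 (sub_zero 0)
  filter_upwards [nhdsWithin_le_nhds hspec, nhdsWithin_le_nhds (hneg.eventually hspec)]
    with h hplus hminus
  have hmid := hconv _ _ (isSelfAdjoint_add_smul hD hH h) (isSelfAdjoint_add_smul hD hH (0 - h))
    hplus hminus (1 / 2) (by norm_num)
  rw [show (1 - 1 / 2 : ℝ) = 1 / 2 by norm_num,
    show (1 / 2 : ℝ) • (D + h • H) + (1 / 2 : ℝ) • (D + (0 - h) • H) = D + (0 : ℝ) • H by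
      module] at hmid
  rw [zero_add]
  exact smul_nonneg (by positivity) (sub_nonneg.2 hmid)

theorem MatrixConvexOn.posSemidef_krausMatrix (hconv : MatrixConvexOn n U f) (hU : IsOpen U)
    (hf : ∀ t ∈ U, ContDiffAt ℝ 2 f t) (hx : ∀ i, x i ∈ U) (k : Fin n) :
    (krausMatrix f x k).PosSemidef := by
  -- The direction `u uᵀ` weights the `k`-th Kraus matrix by `1` and the others by `ε ^ 2`.
  set u : ℝ → Fin n → ℝ := fun ε ↦ Function.update (fun _ ↦ ε) k 1
  have hcont : Continuous fun ε ↦ ∑ m, u ε m ^ 2 • krausMatrix f x m := by fun_prop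
  have hzero : ∑ m, u 0 m ^ 2 • krausMatrix f x m = krausMatrix f x k := by
    rw [Finset.sum_eq_single k (fun m _ hm ↦ by simp [u, hm]) (by simp)]
    simp [u]
  rw [← Matrix.nonneg_iff_posSemidef]
  refine ge_of_tendsto ((hcont.tendsto' 0 _ hzero).mono_left (nhdsWithin_le_nhds (s := {0}ᶜ))) ?_
  filter_upwards [self_mem_nhdsWithin] with ε (hε : ε ≠ 0)
  have hself : IsSelfAdjoint
      (Matrix.vecMulVec (fun i ↦ (u ε i : ℂ)) fun i ↦ (u ε i : ℂ)) :=
    Matrix.IsHermitian.ext fun i j ↦ by simp [Matrix.vecMulVec_apply, mul_comm]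
  have hunit : IsUnit (Matrix.diagonal fun i ↦ (u ε i : ℂ)) := by
    rw [Matrix.isUnit_diagonal, Pi.isUnit_iff]
    intro i
    rcases eq_or_ne i k with rfl | hi <;> simp [u, *]
  have hnonneg := hconv.krausQuadratic_nonneg hU hf hx hself
  rwa [krausQuadratic_vecMulVec_ofReal, Matrix.nonneg_iff_posSemidef,
    Matrix.IsUnit.posSemidef_star_left_conjugate_iff hunit,
    ← Matrix.nonneg_iff_posSemidef] at hnonneg

theorem matrixConvexOn_of_posSemidef_krausMatrix (hU : U.OrdConnected)
    (hf : ∀ t ∈ U, ContDiffAt ℝ 2 f t)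
    (hK : ∀ x : Fin n → ℝ, (∀ i, x i ∈ U) → ∀ k, (krausMatrix f x k).PosSemidef) :
    MatrixConvexOn n U f := by
  intro A B hA hB hAU hBU c hc
  have hcomb (s : ℝ) : IsSelfAdjoint (s • A + (1 - s) • B) :=
    isSelfAdjoint_add_smul ((IsSelfAdjoint.all s).smul hA) hB (1 - s)
  refine le_of_reQuadForm_le (cfc_predicate f _)
    (isSelfAdjoint_add_smul ((IsSelfAdjoint.all c).smul (cfc_predicate f A))
      (cfc_predicate f B) (1 - c)) fun w ↦ ?_
  suffices hconv : ConvexOn ℝ (Set.Icc 0 1)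
      fun s : ℝ ↦ reQuadForm w (cfc f (s • A + (1 - s) • B)) by
    simpa using hconv.2 (Set.right_mem_Icc.2 zero_le_one) (Set.left_mem_Icc.2 zero_le_one) hc.1
      (sub_nonneg.2 hc.2) (add_sub_cancel _ _)
  refine convexOn_of_hasPeanoExpansion (convex_Icc 0 1) fun s hs ↦ ?_
  have hX : (s • A + (1 - s) • B).IsHermitian := hcomb s
  have hXU (i : Fin n) : hX.eigenvalues i ∈ U :=
    spectrum_convex_comb_subset hA hB hU hAU hBU hs.1 (sub_nonneg.2 hs.2) (add_sub_cancel _ _)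
      (hX.eigenvalues_mem_spectrum_real i)
  obtain ⟨b, c, hc, hexp⟩ := exists_nonneg_hasPeanoExpansion_cfc_add_smul hX (hA.sub hB)
    (fun i ↦ hf _ (hXU i)) (hK _ hXU)
  refine ⟨_, _, reQuadForm_nonneg hc w,
    (hexp.clm_comp (reQuadForm w).toContinuousLinearMap).congr_of_shift fun h ↦ ?_⟩
  simp only [LinearMap.coe_toContinuousLinearMap']
  congr 2
  module

theorem MatrixConvexOn.id_mul (hconv : MatrixConvexOn n U g) (hmono : MatrixMonotoneOn n U g)
    (hU : IsOpen U) (hU' : U.OrdConnected) (hU₀ : ∀ t ∈ U, 0 ≤ t)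
    (hg : ∀ t ∈ U, ContDiffAt ℝ 2 g t) : MatrixConvexOn n U fun t ↦ t * g t := by
  refine matrixConvexOn_of_posSemidef_krausMatrix hU'
    (fun t ht ↦ contDiffAt_fun_id.mul (hg t ht)) fun x hx k ↦ ?_
  have hkraus : krausMatrix (fun t ↦ t * g t) x k =
      x k • krausMatrix g x k + loewnerMatrix g x := by
    ext i j
    simp [krausMatrix, loewnerMatrix,
      divDiff₂_id_mul (hg _ (hx k)) ((hg _ (hx i)).differentiableAt two_ne_zero)]
  rw [hkraus]
  exact ((hconv.posSemidef_krausMatrix hU hg hx k).smul (hU₀ _ (hx k))).add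
    (hmono.posSemidef_loewnerMatrix hU hg hx)

theorem MatrixConvexOn.Ico_of_Ioo {l u : ℝ} (hconv : MatrixConvexOn n (Set.Ioo l u) f)
    (hf : ContinuousOn f (Set.Ico l u)) : MatrixConvexOn n (Set.Ico l u) f := by
  have hshift (A : Matrix (Fin n) (Fin n) ℂ) (hA : spectrum ℝ A ⊆ Set.Ico l u) :
      ∀ᶠ ε : ℝ in 𝓝[>] 0, ∀ t ∈ spectrum ℝ A, t + ε ∈ Set.Ioo l u := by
    rw [eventually_all_finite A.finite_real_spectrum]
    intro t ht
    filter_upwards [Ioo_mem_nhdsGT (sub_pos.2 (hA ht).2)] with ε hε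
    exact ⟨lt_add_of_le_of_pos (hA ht).1 hε.1, lt_sub_iff_add_lt'.1 hε.2⟩
  have hlim (A : Matrix (Fin n) (Fin n) ℂ) (hA : IsSelfAdjoint A)
      (hAs : spectrum ℝ A ⊆ Set.Ico l u) : Tendsto
      (fun ε : ℝ ↦ cfc f (A + algebraMap ℝ _ ε)) (𝓝[>] 0) (𝓝 (cfc f A)) := by
    refine tendsto_cfc_add_algebraMap hA A.finite_real_spectrum fun t ht ↦ ?_
    refine (hf t (hAs ht)).tendsto.comp (tendsto_nhdsWithin_iff.2 ⟨?_, ?_⟩)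
    · exact ((continuous_const_add t).tendsto' 0 t (add_zero t)).mono_left nhdsWithin_le_nhds
    · filter_upwards [hshift A hAs] with ε hε using Set.Ioo_subset_Ico_self (hε t ht)
  have hself {A : Matrix (Fin n) (Fin n) ℂ} (hA : IsSelfAdjoint A) (ε : ℝ) :
      IsSelfAdjoint (A + algebraMap ℝ _ ε) :=
    hA.add (.algebraMap _ (.all ε))
  intro A B hA hB hAs hBs c hc
  have hC := isSelfAdjoint_add_smul ((IsSelfAdjoint.all c).smul hA) hB (1 - c)
  have hCs := spectrum_convex_comb_subset hA hB Set.ordConnected_Ico hAs hBs hc.1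
    (sub_nonneg.2 hc.2) (add_sub_cancel _ _)
  refine le_of_tendsto_of_tendsto (hlim _ hC hCs)
    (((hlim A hA hAs).const_smul c).add ((hlim B hB hBs).const_smul (1 - c))) ?_
  filter_upwards [hshift A hAs, hshift B hBs] with ε hAε hBε
  have hcomb : c • (A + algebraMap ℝ _ ε) + (1 - c) • (B + algebraMap ℝ _ ε) =
      c • A + (1 - c) • B + algebraMap ℝ (Matrix (Fin n) (Fin n) ℂ) ε := by
    module
  have := hconv _ _ (hself hA ε) (hself hB ε) (spectrum_add_algebraMap_subset subset_rfl hAε)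
    (spectrum_add_algebraMap_subset subset_rfl hBε) c hc
  rwa [hcomb] at this

lemma MatrixConvexOn.congr {I : Set ℝ} (hf : MatrixConvexOn n I f) (hI : I.OrdConnected)
    (hfg : Set.EqOn f g I) : MatrixConvexOn n I g := by
  intro A B hA hB hAI hBI c hc
  have hcomb := spectrum_convex_comb_subset hA hB hI hAI hBI hc.1 (sub_nonneg.2 hc.2)
    (add_sub_cancel _ _)
  rw [← cfc_congr (hfg.mono hAI), ← cfc_congr (hfg.mono hBI), ← cfc_congr (hfg.mono hcomb)]
  exact hf A B hA hB hAI hBI c hc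

end Criteria

theorem mainTheorem7_general (n : ℕ) (α : ℝ) (f g : ℝ → ℝ)
    (hf : ContDiffOn ℝ 2 f (Set.Ioo 0 α)) (hf₀ : ContinuousOn f (Set.Ico 0 α))
    (hfg : ∀ t ∈ Set.Ioo 0 α, f t = t * g t) :
    ContDiffOn ℝ 2 g (Set.Ioo 0 α) ∧
    (∀ x ∈ Set.Ioo 0 α, ∀ y ∈ Set.Ioo 0 α, ∀ z ∈ Set.Ioo 0 α,
      divDiff₂ f x y z = x * divDiff₂ g x y z + divDiff₁ g y z) ∧
    (MatrixMonotoneOn n (Set.Ioo 0 α) g → MatrixConvexOn n (Set.Ioo 0 α) g →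
      MatrixConvexOn n (Set.Ico 0 α) f) := by
  have hg : ContDiffOn ℝ 2 g (Set.Ioo 0 α) :=
    (hf.div contDiffOn_id fun t ht ↦ ht.1.ne').congr fun t ht ↦
      eq_div_of_mul_eq ht.1.ne' (by rw [id, mul_comm, hfg t ht])
  have hgAt (t : ℝ) (ht : t ∈ Set.Ioo 0 α) : ContDiffAt ℝ 2 g t :=
    hg.contDiffAt (isOpen_Ioo.mem_nhds ht)
  have hjet (t : ℝ) (ht : t ∈ Set.Ioo 0 α) : twoJet f t = twoJet (fun t ↦ t * g t) t :=
    twoJet_congr (eventually_of_mem (isOpen_Ioo.mem_nhds ht) hfg)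
  refine ⟨hg, fun x hx y hy z hz ↦ ?_, fun hmono hconv ↦ ?_⟩
  · rw [divDiff₂_congr (hjet x hx) (hjet y hy) (hjet z hz),
      divDiff₂_id_mul (hgAt x hx) ((hgAt y hy).differentiableAt two_ne_zero)]
  · have hmul := hconv.id_mul hmono isOpen_Ioo Set.ordConnected_Ioo (fun t ht ↦ ht.1.le) hgAt
    exact (hmul.congr Set.ordConnected_Ioo fun t ht ↦ (hfg t ht).symm).Ico_of_Ioo hf₀

theorem mainTheorem7 (n : ℕ) (hn : 0 < n) (α : ℝ) (hα : 0 < α) (f g : ℝ → ℝ)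
    (hf : ContDiffOn ℝ 2 f (Set.Ico 0 α))
    (hfg : ∀ t ∈ Set.Ioo 0 α, f t = t * g t) :
    ContDiffOn ℝ 2 g (Set.Ioo 0 α) ∧
    (∀ t : Fin n → ℝ, Function.Injective t → (∀ i, t i ∈ Set.Ioo 0 α) →
      ∀ i j : Fin n,
        divDiff₂ f (t ⟨0, hn⟩) (t i) (t j) =
          t ⟨0, hn⟩ * divDiff₂ g (t ⟨0, hn⟩) (t i) (t j) + divDiff₁ g (t i) (t j)) ∧
    (MatrixMonotoneOn n (Set.Ioo 0 α) g → MatrixConvexOn n (Set.Ioo 0 α) g →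
      MatrixConvexOn n (Set.Ico 0 α) f) :=
  have ⟨hg, hdivDiff, hconv⟩ := mainTheorem7_general n α f g
    (hf.mono Set.Ioo_subset_Ico_self) hf.continuousOn hfg
  ⟨hg, fun _ _ ht i j ↦ hdivDiff _ (ht _) _ (ht i) _ (ht j), hconv⟩
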